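/- Let $G$ be a finite group and $D(G)$ its Drinfeld double over $\mathbb C$: the Hopf algebra with basis $p_a\bowtie x$ ($a,x\in G$), product $(p_a\bowtie x)(p_b\bowtie y)=\delta_{a,xbx^{-1}}\,p_a\bowtie xy$, coproduct $\Delta(p_a\bowtie x)=\sum_{uv=a}(p_v\bowtie x)\otimes(p_u\bowtie x)$, counit $\varepsilon(p_a\bowtie x)=\delta_{a,1}$ and antipode $S(p_a\bowtie x)=p_{x^{-1}a^{-1}x}\bowtie x^{-1}$. Let $\Lambda$ be its integral with $\varepsilon(\Lambda)=1$. For $m\in\mathbb Z$ the $m$-th Frobenius–Schur indicator of a finite-dimensional $D(G)$-module with character $\Xi$ is $\nu_m(\Xi)=\Xi(\Lambda^{[m]})$, where $\Lambda^{[m]}$ is the $m$-th Sweedler power, i.e. the value at $\Lambda$ of the $m$-th convolution power of $\mathrm{id}_{D(G)}$ (so $\Lambda^{[m]}=\Lambda_{(1)}\cdots\Lambda_{(m)}$ for $m\ge 1$, and $S$ is the convolution inverse of $\mathrm{id}$). Write $\Xi(x,y)=\Xi(p_x\bowtie y)$. For $g\in G$ and a character $\eta$ of $C_G(g)$ afforded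 by a representation $\rho$ on $W$, let $\nu_m(g,\eta)$ be the $m$-th indicator of the $D(G)$-module of all $f:G\to W$ with $f(xc)=\rho(c)^{-1}f(x)$ for $c\in C_G(g)$, on which $p_a\bowtie y$ acts by $((p_a\bowtie y)f)(x)=\delta_{a,xgx^{-1}}f(y^{-1}x)$. For $z\in G$ and $h\in C_G(z)$ put $\gamma_m^z(h)=|\{x\in G: x^m=(hx)^m=z\}|$, and write $z^{H}$ for the set of conjugates of $z$ by elements of $H$. Choose a set $\mathcal R$ of representatives of the conjugacy classes of $G$ and, for each $z\in\mathcal R$, a set $\mathcal R_z$ of representatives of the conjugacy classes of $C_G(z)$. For $z\in\mathcal R$ and $h\in\mathcal R_z$ choose $t(h,z)\in G$ such that $g(h):=t(h,z)\,h\,t(h,z)^{-1}\in\mathcal R$. Then for every $m\in\mathbb Z$: 1. For every character $\Xi$ of a finite-dimensional $D(G)$-module, $$\nu_m(\Xi)=\sum_{z\in\mathcal R}\sum_{h\in\mathcal R_z}\frac{1}{|C_G(h,z)|}\,\gamma_m^z(h)\,\Xi\bigl(g(h),\,t(h,z)\,z\,t(h,z)^{-1}\bigr),$$ where $C_G(h,z)=C_G(h)\cap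 C_G(z)$. 2. For every $g\in\mathcal R$ and every character $\eta$ of $C_G(g)$ (in particular, every irreducible one), $$\nu_m(g,\eta)=\frac1{|C_G(g)|}\sum_{z\in\mathcal R}\ \sum_{\substack{h\in\mathcal R_z\\ g(h)=g}}|z^{C_G(h)}|\,\gamma_m^z(h)\,\eta\bigl(t(h,z)\,z\,t(h,z)^{-1}\bigr).$$ 3. For $g\in\mathcal R$ define $$\mu_m(g)=\frac1{|C_G(g)|}\sum_{z\in\mathcal R}\ \sum_{\substack{h\in\mathcal R_z\\ g(h)=g}}|z^{C_G(h)}|\,\gamma_m^z(h)\,\bigl(t(h,z)\,z\,t(h,z)^{-1}\bigr)\in\mathbb C[C_G(g)].$$ Then $\nu_m(g,\eta)=\eta(\mu_m(g))$ for every character $\eta$ of $C_G(g)$, extended linearly to $\mathbb C[C_G(g)]$. -/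

import Mathlib

open scoped TensorProduct

noncomputable section

/-- The Drinfeld double `D(G)` of a finite group over `ℂ`, with basis `p_a ⋈ x` for `a x : G`, where
`p_a` is the indicator function of `a`. The vector `p_a ⋈ x` is `DrinfeldDouble.basisElem a x`. -/
def DrinfeldDouble (G : Type*) := G × G →₀ ℂ

namespace DrinfeldDouble

section Algebra

variable {G : Type*}

instance : AddCommGroup (DrinfeldDouble G) := inferInstanceAs (AddCommGroup (G × G →₀ ℂ))
instance : Module ℂ (DrinfeldDouble G) := inferInstanceAs (Module ℂ (G × G →₀ ℂ))

/-- The basis vector `p_a ⋈ x` of `D(G)`. -/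
def basisElem (a x : G) : DrinfeldDouble G := Finsupp.single (a, x) (1 : ℂ)

/-- The linear map on `D(G)` with prescribed values on the basis. -/
def lift {M : Type*} [AddCommMonoid M] [Module ℂ M] (f : G → G → M) : DrinfeldDouble G →ₗ[ℂ] M :=
  Finsupp.linearCombination ℂ (fun q : G × G => f q.1 q.2)

@[simp]
theorem lift_basisElem {M : Type*} [AddCommMonoid M] [Module ℂ M] (f : G → G → M) (a x : G) :
    lift f (basisElem a x) = f a x := by
  exact (Finsupp.linearCombination_single ℂ (1 : ℂ) (a, x)).trans (one_smul ℂ (f a x))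

theorem lhom_ext {M : Type*} [AddCommMonoid M] [Module ℂ M] {φ ψ : DrinfeldDouble G →ₗ[ℂ] M}
    (h : ∀ a x, φ (basisElem a x) = ψ (basisElem a x)) : φ = ψ := by
  refine Finsupp.lhom_ext' fun q => LinearMap.ext_ring ?_
  exact h q.1 q.2

variable [Group G] [DecidableEq G]

/-- The product of `D(G)`: `(p_a ⋈ x)(p_b ⋈ y) = p_a ⋈ xy` if `a = x b x⁻¹`, and `0` otherwise. -/
def mulMap : DrinfeldDouble G →ₗ[ℂ] DrinfeldDouble G →ₗ[ℂ] DrinfeldDouble G :=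
  lift fun a x => lift fun b y => if a = x * b * x⁻¹ then basisElem a (x * y) else 0

theorem mulMap_basisElem (a x b y : G) : mulMap (basisElem a x) (basisElem b y) =
    if a = x * b * x⁻¹ then basisElem a (x * y) else 0 := by
  simp [mulMap]

theorem mulMap_assoc (u v w : DrinfeldDouble G) :
    mulMap (mulMap u v) w = mulMap u (mulMap v w) := by
  have h : (LinearMap.llcomp ℂ _ _ _ mulMap).comp mulMap =
      ((LinearMap.llcomp ℂ (DrinfeldDouble G) _ _).flip mulMap).comp
        ((LinearMap.llcomp ℂ (DrinfeldDouble G) (DrinfeldDouble G) (DrinfeldDouble G)).comp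
          mulMap) := by
    refine lhom_ext fun a x => lhom_ext fun b y => lhom_ext fun c z => ?_
    simp only [LinearMap.comp_apply, LinearMap.llcomp_apply, LinearMap.flip_apply, mulMap_basisElem]
    by_cases h1 : a = x * b * x⁻¹ <;> by_cases h2 : b = y * c * y⁻¹
    · subst h2; subst h1
      simp [mulMap_basisElem, mul_assoc]
    · have : ¬ a = x * y * c * (x * y)⁻¹ := by
        intro h; apply h2; rw [h1] at h
        have := congrArg (fun k => x⁻¹ * k * x) h
        simpa [mul_assoc] using this
      rw [if_pos h1, if_neg h2, mulMap_basisElem, if_neg this, map_zero]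
    · rw [if_neg h1, if_pos h2, mulMap_basisElem, if_neg h1, map_zero, LinearMap.zero_apply]
    · simp [h1, h2]
  exact LinearMap.congr_fun (LinearMap.congr_fun (LinearMap.congr_fun h u) v) w

variable [Fintype G]

/-- The unit `∑ a, p_a ⋈ 1` of `D(G)`. -/
def unit : DrinfeldDouble G := ∑ a : G, basisElem a 1

theorem unit_mulMap (u : DrinfeldDouble G) : mulMap unit u = u := by
  have h : mulMap unit = (LinearMap.id : DrinfeldDouble G →ₗ[ℂ] DrinfeldDouble G) := by
    refine lhom_ext fun a x => ?_
    simp [unit, LinearMap.sum_apply, mulMap_basisElem]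
  exact LinearMap.congr_fun h u

theorem mulMap_unit (u : DrinfeldDouble G) : mulMap u unit = u := by
  have h : mulMap.flip unit = (LinearMap.id : DrinfeldDouble G →ₗ[ℂ] DrinfeldDouble G) := by
    refine lhom_ext fun a x => ?_
    have h' : ∀ b : G, (a = x * b * x⁻¹) ↔ (x⁻¹ * a * x = b) := by
      intro b; constructor <;> rintro rfl <;> group
    simp [unit, mulMap_basisElem, h']
  exact LinearMap.congr_fun h u

instance : Ring (DrinfeldDouble G) where
  mul u v := mulMap u v
  one := unit
  left_distrib u v w := map_add (mulMap u) v w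
  right_distrib u v w := by
    change mulMap (u + v) w = mulMap u w + mulMap v w
    rw [map_add, LinearMap.add_apply]
  zero_mul u := by
    change mulMap 0 u = 0
    rw [map_zero, LinearMap.zero_apply]
  mul_zero u := map_zero (mulMap u)
  mul_assoc := mulMap_assoc
  one_mul := unit_mulMap
  mul_one := mulMap_unit
  __ := (inferInstance : AddCommGroup (DrinfeldDouble G))

instance : Algebra ℂ (DrinfeldDouble G) :=
  Algebra.ofModule
    (fun r u v => by
      change mulMap (r • u) v = r • mulMap u v
      rw [map_smul, LinearMap.smul_apply])
    (fun r u v => map_smul (mulMap u) r v)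

theorem one_def : (1 : DrinfeldDouble G) = ∑ a : G, basisElem a 1 := rfl

theorem basisElem_mul (a x b y : G) : basisElem a x * basisElem b y =
    if a = x * b * x⁻¹ then basisElem a (x * y) else 0 :=
  mulMap_basisElem a x b y

/-- The comultiplication `Δ(p_a ⋈ x) = ∑_{u v = a} (p_v ⋈ x) ⊗ (p_u ⋈ x)` and the counit
`ε(p_a ⋈ x) = δ_{a,1}`. -/
instance : CoalgebraStruct ℂ (DrinfeldDouble G) where
  comul := lift fun a x => ∑ v : G, basisElem v x ⊗ₜ[ℂ] basisElem (a * v⁻¹) x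
  counit := lift fun a _ => if a = 1 then 1 else 0

theorem comul_basisElem (a x : G) : Coalgebra.comul (R := ℂ) (basisElem a x) =
    ∑ v : G, basisElem v x ⊗ₜ[ℂ] basisElem (a * v⁻¹) x :=
  lift_basisElem _ a x

theorem counit_basisElem (a x : G) :
    Coalgebra.counit (R := ℂ) (basisElem a x) = if a = 1 then (1 : ℂ) else 0 :=
  lift_basisElem _ a x

instance : Coalgebra ℂ (DrinfeldDouble G) where
  coassoc := by
    refine lhom_ext fun a x => ?_
    simp only [LinearMap.comp_apply, comul_basisElem, map_sum, LinearMap.rTensor_tmul,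
      LinearMap.lTensor_tmul, TensorProduct.sum_tmul, TensorProduct.tmul_sum,
      LinearEquiv.coe_coe, TensorProduct.assoc_tmul]
    rw [Finset.sum_comm]
    refine Finset.sum_congr rfl fun w _ => ?_
    refine Fintype.sum_equiv (Equiv.mulRight w⁻¹) _ _ fun v => ?_
    simp [mul_assoc]
  rTensor_counit_comp_comul := by
    refine lhom_ext fun a x => ?_
    simp only [LinearMap.comp_apply, comul_basisElem, map_sum, LinearMap.rTensor_tmul,
      counit_basisElem, TensorProduct.mk_apply]
    rw [Finset.sum_eq_single 1] <;> simp +contextual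
  lTensor_counit_comp_comul := by
    refine lhom_ext fun a x => ?_
    simp only [LinearMap.comp_apply, comul_basisElem, map_sum, LinearMap.lTensor_tmul,
      counit_basisElem, LinearMap.flip_apply, TensorProduct.mk_apply]
    rw [Finset.sum_eq_single a]
    · simp
    · intro b _ hb
      rw [if_neg (by rw [mul_inv_eq_one]; exact fun h => hb h.symm), TensorProduct.tmul_zero]
    · simp

instance : Bialgebra ℂ (DrinfeldDouble G) where
  counit_one := by
    simp [one_def, counit_basisElem]
  mul_compr₂_counit := by
    refine lhom_ext fun a x => lhom_ext fun b y => ?_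
    simp only [LinearMap.compr₂_apply, LinearMap.mul_apply', LinearMap.compl₁₂_apply,
      basisElem_mul, counit_basisElem]
    by_cases h : a = x * b * x⁻¹
    · subst h; simp [counit_basisElem]
    · rw [if_neg h]
      by_cases hb : b = 1
      · subst hb; simp at h; simp [h]
      · simp [hb]
  comul_one := by
    simp only [one_def, map_sum, comul_basisElem, Algebra.TensorProduct.one_def,
      TensorProduct.sum_tmul, TensorProduct.tmul_sum]
    rw [Finset.sum_comm]
    nth_rewrite 2 [Finset.sum_comm]
    refine Finset.sum_congr rfl fun v _ => ?_
    exact Fintype.sum_equiv (Equiv.mulRight v⁻¹) _ _ fun a => rfl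
  mul_compr₂_comul := by
    refine lhom_ext fun a x => lhom_ext fun b y => ?_
    simp only [LinearMap.compr₂_apply, LinearMap.mul_apply', LinearMap.compl₁₂_apply,
      basisElem_mul, comul_basisElem, Finset.sum_mul_sum, Algebra.TensorProduct.tmul_mul_tmul]
    have h' : ∀ v w : G, (v = x * w * x⁻¹) ↔ (w = x⁻¹ * v * x) := by
      intro v w; constructor <;> rintro rfl <;> group
    by_cases h : a = x * b * x⁻¹
    · rw [if_pos h, comul_basisElem]
      refine Finset.sum_congr rfl fun v _ => ?_
      rw [Finset.sum_eq_single (x⁻¹ * v * x)]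
      · rw [if_pos (by group), if_pos (by subst h; group)]
      · intro w _ hw
        rw [if_neg (fun e => hw ((h' v w).1 e)), TensorProduct.zero_tmul]
      · simp
    · rw [if_neg h, map_zero]
      symm
      refine Finset.sum_eq_zero fun v _ => Finset.sum_eq_zero fun w _ => ?_
      by_cases hv : v = x * w * x⁻¹
      · rw [if_neg (c := a * v⁻¹ = _), TensorProduct.tmul_zero]
        subst hv
        intro e; apply h
        have := congrArg (fun k => k * (x * w * x⁻¹)) e
        simpa [mul_assoc] using this
      · rw [if_neg hv, TensorProduct.zero_tmul]

/-- The antipode `S(p_a ⋈ x) = p_{x⁻¹ a⁻¹ x} ⋈ x⁻¹`. -/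
instance : HopfAlgebra ℂ (DrinfeldDouble G) where
  antipode := lift fun a x => basisElem (x⁻¹ * a⁻¹ * x) x⁻¹
  mul_antipode_rTensor_comul := by
    refine lhom_ext fun a x => ?_
    simp only [LinearMap.comp_apply, comul_basisElem, map_sum, LinearMap.rTensor_tmul,
      lift_basisElem, LinearMap.mul'_apply, basisElem_mul, counit_basisElem, Algebra.linearMap_apply]
    by_cases h : a = 1
    · subst h
      simp only [one_mul, inv_inv, if_true, map_one, one_def, inv_mul_cancel]
      exact Fintype.sum_equiv ((Equiv.inv G).trans (MulAut.conj x⁻¹).toEquiv) _ _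
        fun v => by simp [mul_assoc]
    · rw [if_neg h, map_zero]
      refine Finset.sum_eq_zero fun v _ => if_neg fun e => h ?_
      have := congrArg (fun k => x * k * x⁻¹ * v) e
      simpa [mul_assoc] using this.symm
  mul_antipode_lTensor_comul := by
    refine lhom_ext fun a x => ?_
    simp only [LinearMap.comp_apply, comul_basisElem, map_sum, LinearMap.lTensor_tmul,
      lift_basisElem, LinearMap.mul'_apply, basisElem_mul, counit_basisElem, Algebra.linearMap_apply]
    by_cases h : a = 1
    · subst h
      simp [mul_assoc, one_def]
    · rw [if_neg h, map_zero]
      refine Finset.sum_eq_zero fun v _ => if_neg fun e => h ?_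
      have := congrArg (fun k => v⁻¹ * k) e
      simpa [mul_assoc] using this

/-- The integral `Λ = |G|⁻¹ ∑ y, p_1 ⋈ y` of `D(G)`. -/
def integral (G : Type*) [Group G] [DecidableEq G] [Fintype G] : DrinfeldDouble G :=
  (Nat.card G : ℂ)⁻¹ • ∑ y : G, basisElem 1 y

theorem mul_integral (u : DrinfeldDouble G) :
    u * integral G = Coalgebra.counit (R := ℂ) u • integral G := by
  have h : LinearMap.mulRight ℂ (integral G) =
      (Coalgebra.counit (R := ℂ) (A := DrinfeldDouble G)).smulRight (integral G) := by
    refine lhom_ext fun a x => ?_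
    simp only [LinearMap.mulRight_apply, LinearMap.smulRight_apply, integral, mul_smul_comm,
      Finset.mul_sum, basisElem_mul, counit_basisElem, mul_one, mul_inv_cancel]
    by_cases h : a = 1
    · subst h
      simp only [if_true, one_smul]
      congr 1
      exact Fintype.sum_equiv (Equiv.mulLeft x) _ _ fun y => rfl
    · simp [h]
  exact LinearMap.congr_fun h u

theorem integral_mul (u : DrinfeldDouble G) :
    integral G * u = Coalgebra.counit (R := ℂ) u • integral G := by
  have h : LinearMap.mulLeft ℂ (integral G) =
      (Coalgebra.counit (R := ℂ) (A := DrinfeldDouble G)).smulRight (integral G) := by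
    refine lhom_ext fun a x => ?_
    have h' : ∀ y : G, (1 = y * a * y⁻¹) ↔ (a = 1) := by
      intro y
      rw [eq_comm, mul_inv_eq_one, mul_eq_left]
    simp only [LinearMap.mulLeft_apply, LinearMap.smulRight_apply, integral, smul_mul_assoc,
      Finset.sum_mul, basisElem_mul, counit_basisElem, h']
    by_cases h : a = 1
    · subst h
      simp only [if_true, one_smul]
      congr 1
      exact Fintype.sum_equiv (Equiv.mulRight x) _ _ fun y => rfl
    · simp [h]
  exact LinearMap.congr_fun h u

theorem counit_integral : Coalgebra.counit (R := ℂ) (integral G) = (1 : ℂ) := by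
  simp [integral, counit_basisElem]

/-- `Λ` is the only left integral of `D(G)` with `ε(Λ) = 1`. -/
theorem eq_integral (L : DrinfeldDouble G)
    (hL : ∀ u : DrinfeldDouble G, u * L = Coalgebra.counit (R := ℂ) u • L)
    (h1 : Coalgebra.counit (R := ℂ) L = (1 : ℂ)) : L = integral G := by
  have h2 := hL (integral G)
  rw [counit_integral, one_smul, integral_mul, h1, one_smul] at h2
  exact h2.symm

end Algebra

end DrinfeldDouble

/-- The `m`-th Sweedler power `a ↦ a₍₁₎ a₍₂₎ ⋯ a₍ₘ₎` of a Hopf algebra, that is, the `m`-th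
power of the identity in the convolution algebra of linear endomorphisms; negative powers are
powers of the antipode, which is the convolution inverse of the identity. -/
def sweedlerPower {A : Type*} [Ring A] [HopfAlgebra ℂ A] : ℤ → A →ₗ[ℂ] A
  | Int.ofNat n => (WithConv.toConv (LinearMap.id : A →ₗ[ℂ] A) ^ n).ofConv
  | Int.negSucc n => (WithConv.toConv (HopfAlgebra.antipode ℂ (A := A)) ^ (n + 1)).ofConv

namespace DrinfeldDouble

section Modules

variable {G : Type*} [Group G] [DecidableEq G] [Fintype G]

/-- The character `Ξ(x, y)` of a `D(G)`-module: the trace of `p_x ⋈ y`. -/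
def character {V : Type*} [AddCommGroup V] [Module ℂ V]
    (π : DrinfeldDouble G →ₐ[ℂ] Module.End ℂ V) (x y : G) : ℂ :=
  LinearMap.trace ℂ V (π (basisElem x y))

/-- The `m`-th Frobenius-Schur indicator of a `D(G)`-module: the value of its character on the
`m`-th Sweedler power of the normalized integral. -/
def indicator (m : ℤ) {V : Type*} [AddCommGroup V] [Module ℂ V]
    (π : DrinfeldDouble G →ₐ[ℂ] Module.End ℂ V) : ℂ :=
  LinearMap.trace ℂ V (π (sweedlerPower m (integral G)))

variable {W : Type*} [AddCommGroup W] [Module ℂ W] (g : G)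
  (ρ : Representation ℂ (Subgroup.centralizer {g}) W)

/-- The space of the `D(G)`-module attached to `g` and a representation `ρ` of `C_G(g)` on `W`:
the space of the representation of `G` induced from `ρ`, that is, of the functions
`f : G → W` with `f(x c) = ρ(c)⁻¹ f(x)` for `c ∈ C_G(g)`. -/
def moduleSpace : Submodule ℂ (G → W) where
  carrier := {f | ∀ (x : G) (c : Subgroup.centralizer {g}), f (x * c) = ρ c⁻¹ (f x)}
  add_mem' := by
    intro f f' hf hf' x c
    simp [hf x c, hf' x c]
  zero_mem' := by
    intro x c
    simp
  smul_mem' := by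
    intro r f hf x c
    simp [hf x c]

/-- The action of `p_a ⋈ y`: translation by `y`, followed by restriction to the left cosets
`x C_G(g)` with `x g x⁻¹ = a`. -/
def moduleAct (a y : G) : Module.End ℂ (moduleSpace g ρ) where
  toFun f := ⟨fun x => if a = x * g * x⁻¹ then f.1 (y⁻¹ * x) else 0, by
    intro x c
    have hc : (c : G) * g * (c : G)⁻¹ = g := by
      have := Subgroup.mem_centralizer_singleton_iff.1 c.2
      rw [this, mul_inv_cancel_right]
    have h : x * c * g * (x * c)⁻¹ = x * g * x⁻¹ := by
      calc x * c * g * (x * c)⁻¹ = x * (c * g * (c : G)⁻¹) * x⁻¹ := by group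
        _ = x * g * x⁻¹ := by rw [hc]
    change (if a = x * c * g * (x * c)⁻¹ then f.1 (y⁻¹ * (x * c)) else 0) =
      ρ c⁻¹ (if a = x * g * x⁻¹ then f.1 (y⁻¹ * x) else 0)
    rw [h]
    split_ifs
    · rw [← mul_assoc, f.2]
    · simp⟩
  map_add' f f' := by
    ext x
    by_cases h : a = x * g * x⁻¹ <;> simp [h]
  map_smul' r f := by
    ext x
    by_cases h : a = x * g * x⁻¹ <;> simp [h]

set_option linter.unusedSectionVars false in
theorem moduleAct_apply (a y : G) (f : moduleSpace g ρ) (x : G) :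
    (moduleAct g ρ a y f).1 x = if a = x * g * x⁻¹ then f.1 (y⁻¹ * x) else 0 := rfl

theorem moduleAct_one : lift (moduleAct g ρ) 1 = 1 := by
  rw [one_def, map_sum]
  refine LinearMap.ext fun f => Subtype.ext (funext fun x => ?_)
  simp [LinearMap.sum_apply, moduleAct_apply]

theorem moduleAct_mul (a x b y : G) :
    lift (moduleAct g ρ) (basisElem a x * basisElem b y) =
      moduleAct g ρ a x * moduleAct g ρ b y := by
  refine LinearMap.ext fun f => Subtype.ext (funext fun w => ?_)
  have e : b = x⁻¹ * w * g * (x⁻¹ * w)⁻¹ ↔ x * b * x⁻¹ = w * g * w⁻¹ := by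
    constructor
    · rintro rfl; group
    · intro h
      have := congrArg (fun k => x⁻¹ * k * x) h
      simpa [mul_assoc] using this
  rw [Module.End.mul_apply, moduleAct_apply, moduleAct_apply, basisElem_mul]
  simp only [e]
  by_cases h1 : a = x * b * x⁻¹
  · rw [if_pos h1, lift_basisElem, moduleAct_apply, ← h1]
    by_cases h2 : a = w * g * w⁻¹
    · rw [if_pos h2, if_pos h2, if_pos h2, mul_inv_rev, mul_assoc]
    · rw [if_neg h2, if_neg h2]
  · rw [if_neg h1, map_zero]
    by_cases h2 : a = w * g * w⁻¹
    · rw [if_pos h2, if_neg fun h => h1 (h2.trans h.symm)]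
      rfl
    · rw [if_neg h2]
      rfl

theorem moduleAct_lift_mul (u v : DrinfeldDouble G) :
    lift (moduleAct g ρ) (u * v) = lift (moduleAct g ρ) u * lift (moduleAct g ρ) v := by
  have h1 : ∀ a x : G, (lift (moduleAct g ρ)).comp (LinearMap.mulLeft ℂ (basisElem a x)) =
      (LinearMap.mulLeft ℂ (moduleAct g ρ a x)).comp (lift (moduleAct g ρ)) := by
    intro a x
    refine lhom_ext fun b y => ?_
    rw [LinearMap.comp_apply, LinearMap.comp_apply, LinearMap.mulLeft_apply,
      LinearMap.mulLeft_apply, lift_basisElem, moduleAct_mul]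
  have h2 : (lift (moduleAct g ρ)).comp (LinearMap.mulRight ℂ v) =
      (LinearMap.mulRight ℂ (lift (moduleAct g ρ) v)).comp (lift (moduleAct g ρ)) := by
    refine lhom_ext fun a x => ?_
    have := LinearMap.congr_fun (h1 a x) v
    rw [LinearMap.comp_apply, LinearMap.comp_apply, LinearMap.mulRight_apply,
      LinearMap.mulRight_apply, lift_basisElem]
    exact this
  exact LinearMap.congr_fun h2 u

/-- The `D(G)`-module attached to `g ∈ G` and a representation `ρ` of `C_G(g)`. -/
def module : DrinfeldDouble G →ₐ[ℂ] Module.End ℂ (moduleSpace g ρ) :=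
  AlgHom.ofLinearMap (lift (moduleAct g ρ)) (moduleAct_one g ρ) (moduleAct_lift_mul g ρ)

end Modules

end DrinfeldDouble

/-- A set of representatives of the conjugacy classes of a group. -/
def IsClassReps {H : Type*} [Group H] (R : Finset H) : Prop :=
  ∀ x : H, ∃! r : H, r ∈ R ∧ IsConj r x

section Formula

variable {G : Type*} [Group G]

/-- The set `G_m(g, z) = {x ∈ G | x ^ m = (g x) ^ m = z}`. -/
def powerSet (m : ℤ) (g z : G) : Set G := {x | x ^ m = z ∧ (g * x) ^ m = z}

/-- The function `γ_m^z` on `C_G(z)`, with value `|G_m(g, z)|` at `g`. -/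
def gammaFun (m : ℤ) (z : G) (g : Subgroup.centralizer {z}) : ℂ :=
  ((powerSet m (g : G) z).ncard : ℂ)

/-- The conjugacy class `z ^ H` of `z` under a subgroup `H`. -/
def subgroupClass (H : Subgroup G) (z : G) : Set G := {w | ∃ c ∈ H, c * z * c⁻¹ = w}

/-- If `h` commutes with `z` and `t h t⁻¹ = g`, then `t z t⁻¹` lies in `C_G(g)`. -/
theorem conj_mem_centralizer {g z t : G} (h : Subgroup.centralizer {z})
    (hg : t * (h : G) * t⁻¹ = g) : t * z * t⁻¹ ∈ Subgroup.centralizer {g} := by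
  have hz := Subgroup.mem_centralizer_singleton_iff.1 h.2
  rw [Subgroup.mem_centralizer_singleton_iff, ← hg]
  calc t * z * t⁻¹ * (t * (h : G) * t⁻¹) = t * (z * (h : G)) * t⁻¹ := by group
    _ = t * ((h : G) * z) * t⁻¹ := by rw [hz]
    _ = t * (h : G) * t⁻¹ * (t * z * t⁻¹) := by group

/-- The linear extension to the group algebra of a function on the group. -/
def extendToGroupAlgebra {H : Type*} (η : H → ℂ) (u : MonoidAlgebra ℂ H) : ℂ :=
  u.coeff.sum fun c r => r * η c

variable [DecidableEq G]

/-- The element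
`μ_m(g) = |C_G(g)|⁻¹ ∑_{z ∈ R} ∑_{h ∈ S(z), t h t⁻¹ = g} |z ^ C_G(h)| γ_m^z(h) (t z t⁻¹)`
of `ℂ[C_G(g)]`, where `t = t(h, z)`. -/
def muElem (m : ℤ) (R : Finset G) (S : (z : G) → Finset (Subgroup.centralizer {z}))
    (t : (z : G) → Subgroup.centralizer {z} → G) (g : G) :
    MonoidAlgebra ℂ (Subgroup.centralizer {g}) :=
  (Nat.card (Subgroup.centralizer {g}) : ℂ)⁻¹ • ∑ z ∈ R, ∑ h ∈ S z,
    if hg : t z h * (h : G) * (t z h)⁻¹ = g then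
      MonoidAlgebra.single (⟨t z h * z * (t z h)⁻¹, conj_mem_centralizer h hg⟩)
        (((subgroupClass (Subgroup.centralizer {(h : G)}) z).ncard : ℂ) * gammaFun m z h)
    else 0

end Formula

end

/-! In an `m`-fold Sweedler product of `p_a ⋈ x` with `m ≥ 1`, the product rule forces the
successive indices to be `v`, `x⁻¹ v x`, `x⁻² v x²`, …; the coproduct requires their product in
reverse order to be `a`, which says `x ^ m * a = (x * v) ^ m`. This closed form makes sense for
every integer `m`, is additive in `m` under convolution, and gives the antipode at `-1`, so it
describes all Sweedler powers (`sweedlerPower_eq_powerMap`).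

Evaluated at the integral, it gives `ν_m(Ξ) = |G|⁻¹ ∑_{z,h} γ_m^z(h) Ξ(h, z)`, where only commuting
pairs contribute. The summand is invariant under simultaneous conjugation (`ncard_powerSet_conj`,
`character_conj`), so class sums over `G` and then over `C_G(z)` reduce it to representatives
(`indicator_eq_sum_reps`); the same invariance inserts `t(h, z)`.

For the induced module, `Ξ(g, y) = η(y)` on `C_G(g)`, and `Ξ(a, y) = 0` when `a` is not conjugate to
`g`. Hence only terms with `g(h) = g` survive, and orbit-stabilizer rewrites their weights. The
element `μ_m(g)` then follows by linearity. -/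

namespace DrinfeldDouble

/-! ### Sweedler powers in closed form. -/

section SweedlerPowers

variable {G : Type*} [Group G] [DecidableEq G] [Fintype G]

/-- The linear endomorphism `p_a ⋈ x ↦ ∑_{x ^ m a = (x v) ^ m} p_v ⋈ x ^ m` of `D(G)`. -/
noncomputable def powerMap (m : ℤ) : DrinfeldDouble G →ₗ[ℂ] DrinfeldDouble G :=
  lift fun a x => ∑ v : G, if x ^ m * a = (x * v) ^ m then basisElem v (x ^ m) else 0

theorem powerMap_basisElem (m : ℤ) (a x : G) : powerMap m (basisElem a x) =
    ∑ v : G, if x ^ m * a = (x * v) ^ m then basisElem v (x ^ m) else 0 :=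
  lift_basisElem _ a x

/-- This additivity in the exponent reduces every Sweedler power to the exponents `0`, `1` and `-1`.
-/
theorem powerMap_convMul (m n : ℤ) :
    WithConv.toConv (powerMap m : DrinfeldDouble G →ₗ[ℂ] DrinfeldDouble G) *
      WithConv.toConv (powerMap n) = WithConv.toConv (powerMap (m + n)) := by
  rw [LinearMap.convMul_def]
  congr 1
  refine lhom_ext fun a x => ?_
  simp only [LinearMap.comp_apply, comul_basisElem, map_sum, TensorProduct.map_tmul,
    LinearMap.mul'_apply, powerMap_basisElem, Finset.sum_mul_sum]
  rw [Finset.sum_comm]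
  refine Finset.sum_congr rfl fun v _ => ?_
  -- The first factor's condition fixes the coproduct index; the product rule in `D(G)` then fixes
  -- the index of the second factor.
  rw [Finset.sum_eq_single ((x ^ m)⁻¹ * (x * v) ^ m), Finset.sum_eq_single ((x ^ m)⁻¹ * v * x ^ m)]
  · have e : (x ^ n * (a * ((x ^ m)⁻¹ * (x * v) ^ m)⁻¹) = (x * ((x ^ m)⁻¹ * v * x ^ m)) ^ n) ↔
        x ^ (m + n) * a = (x * v) ^ (m + n) := by
      -- As `x` commutes with `x ^ m`, the condition for exponent `n` concerns a conjugate of `x *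
      -- v`, and the two powers of `x * v` combine.
      have h1 : x * ((x ^ m)⁻¹ * v * x ^ m) = (x ^ m)⁻¹ * (x * v) * ((x ^ m)⁻¹)⁻¹ := by
        have : x * (x ^ m)⁻¹ = (x ^ m)⁻¹ * x := ((Commute.refl x).zpow_right m).inv_right.eq
        rw [inv_inv, ← mul_assoc, ← mul_assoc, this, ← mul_assoc]
      have h2 : (x ^ m)⁻¹ * (x * v) ^ n * x ^ m * ((x ^ m)⁻¹ * (x * v) ^ m) =
          (x ^ m)⁻¹ * (x * v) ^ (m + n) := by
        rw [add_comm m n, zpow_add (x * v)]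
        simp only [mul_assoc, mul_inv_cancel_left]
      rw [h1, conj_zpow, inv_inv, ← mul_assoc, mul_inv_eq_iff_eq_mul, h2, eq_inv_mul_iff_mul_eq,
        ← mul_assoc, ← zpow_add]
    simp only [e, mul_inv_cancel_left, if_true]
    split_ifs
    · rw [basisElem_mul, if_pos (by group), zpow_add]
    · rw [mul_zero]
  · intro u _ hu
    split_ifs
    · rw [basisElem_mul, if_neg]
      rintro rfl
      exact hu (by group)
    all_goals simp
  · simp
  · intro w _ hw
    refine Finset.sum_eq_zero fun u _ => ?_
    rw [if_neg, zero_mul]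
    intro h
    exact hw (by rw [← h]; group)
  · simp

theorem toConv_powerMap_zero :
    WithConv.toConv (powerMap 0 : DrinfeldDouble G →ₗ[ℂ] DrinfeldDouble G) = 1 := by
  rw [LinearMap.convOne_def]
  congr 1
  refine lhom_ext fun a x => ?_
  by_cases h : a = 1 <;> simp [powerMap_basisElem, counit_basisElem, one_def, h]

theorem powerMap_one : (powerMap 1 : DrinfeldDouble G →ₗ[ℂ] DrinfeldDouble G) = LinearMap.id := by
  refine lhom_ext fun a x => ?_
  simp [powerMap_basisElem]

theorem powerMap_neg_one : (powerMap (-1) : DrinfeldDouble G →ₗ[ℂ] DrinfeldDouble G) =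
    HopfAlgebra.antipode ℂ := by
  refine lhom_ext fun a x => ?_
  have e : ∀ v : G, (x⁻¹ * a = v⁻¹ * x⁻¹) ↔ v = x⁻¹ * a⁻¹ * x := by
    intro v
    rw [← mul_inv_rev, eq_inv_iff_mul_eq_one]
    constructor
    · intro h
      have := congrArg (fun k => x⁻¹ * a⁻¹ * x * k) h
      simpa [mul_assoc] using this
    · rintro rfl; group
  rw [powerMap_basisElem]
  simp only [zpow_neg_one, mul_inv_rev, e, Finset.sum_ite_eq', Finset.mem_univ, if_true]
  exact (lift_basisElem (fun a x : G => basisElem (x⁻¹ * a⁻¹ * x) x⁻¹) a x).symm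

/-- Taking `m = 1` and `m = -1` gives the two branches of `sweedlerPower`. -/
theorem toConv_powerMap_pow (m : ℤ) (n : ℕ) :
    WithConv.toConv (powerMap m : DrinfeldDouble G →ₗ[ℂ] DrinfeldDouble G) ^ n =
      WithConv.toConv (powerMap (n * m)) := by
  induction n with
  | zero => simp [toConv_powerMap_zero]
  | succ n ih => rw [pow_succ, ih, powerMap_convMul]; push_cast; ring_nf

/-- The Sweedler powers of `D(G)` on the basis. -/
theorem sweedlerPower_eq_powerMap (m : ℤ) :
    (sweedlerPower m : DrinfeldDouble G →ₗ[ℂ] DrinfeldDouble G) = powerMap m := by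
  cases m with
  | ofNat n =>
    rw [sweedlerPower, ← powerMap_one (G := G), toConv_powerMap_pow]
    simp
  | negSucc n =>
    rw [sweedlerPower, ← powerMap_neg_one (G := G), toConv_powerMap_pow]
    simp [Int.negSucc_eq]

/-- The indicators as sums over pairs of group elements. -/
theorem indicator_eq_sum_prod (m : ℤ) {V : Type*} [AddCommGroup V] [Module ℂ V]
    (π : DrinfeldDouble G →ₐ[ℂ] Module.End ℂ V) :
    indicator m π = (Nat.card G : ℂ)⁻¹ *
      ∑ y : G, ∑ v : G, if (v * y) ^ m = y ^ m then character π v (y ^ m) else 0 := by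
  -- Conjugation by `y` carries `v * y` to `y * v` and fixes `y ^ m`.
  have e : ∀ y v : G, (y ^ m = (y * v) ^ m) ↔ (v * y) ^ m = y ^ m := by
    intro y v
    have h : y * v = y * (v * y) * y⁻¹ := by group
    rw [h, conj_zpow, eq_mul_inv_iff_mul_eq, eq_comm, ((Commute.refl y).zpow_left m).eq]
    exact mul_right_inj y
  simp only [indicator, sweedlerPower_eq_powerMap, integral, map_smul, map_sum,
    powerMap_basisElem, mul_one, e, apply_ite, map_zero, smul_eq_mul, character]

end SweedlerPowers

end DrinfeldDouble

/-! ### Conjugacy classes and centralizer orders. -/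

namespace Subgroup

variable {G : Type*} [Group G]

/-- The orbit-stabilizer relation for the conjugation action of a subgroup. -/
theorem ncard_subgroupClass_mul_card (K : Subgroup G) (z : G) :
    (subgroupClass K z).ncard * Nat.card (K ⊓ centralizer {z} : Subgroup G) = Nat.card K := by
  let _ : MulAction K G := MulAction.compHom G (MulAut.conj.comp K.subtype)
  have hs : ∀ (c : K) (x : G), c • x = (c : G) * x * (c : G)⁻¹ := fun _ _ => rfl
  have h1 : subgroupClass K z = MulAction.orbit K z := by
    ext w
    simp [subgroupClass, MulAction.mem_orbit_iff, hs]
  have h2 : MulAction.stabilizer K z = (centralizer {z}).subgroupOf K := by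
    ext c
    rw [MulAction.mem_stabilizer_iff, hs, mem_subgroupOf, mem_centralizer_singleton_iff,
      mul_inv_eq_iff_eq_mul]
  have h3 : Nat.card (K ⊓ centralizer {z} : Subgroup G) =
      Nat.card ((centralizer {z}).subgroupOf K) := by
    rw [← inf_subgroupOf_left]
    exact (Nat.card_congr (subgroupOfEquivOfLe inf_le_left).toEquiv).symm
  rw [h1, h3, ← h2, ← MulAction.index_stabilizer, mul_comm, card_mul_index]

end Subgroup

/-- The sum of a class function over a finite group as a sum over class representatives. -/
theorem IsClassReps.sum_eq {H : Type*} [Group H] [Fintype H] {R : Finset H} (hR : IsClassReps R)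
    (φ : H → ℂ) (hφ : ∀ c x : H, φ (c * x * c⁻¹) = φ x) :
    ∑ x, φ x = ∑ r ∈ R, (Nat.card H : ℂ) / Nat.card (Subgroup.centralizer {r}) * φ r := by
  classical
  -- Exactly one representative is conjugate to `x`; after interchanging the sums, each `φ r` is
  -- counted once per element of its class.
  have h1 : ∀ x, φ x = ∑ r ∈ R, if IsConj r x then φ r else 0 := by
    intro x
    obtain ⟨r, ⟨hr, hrx⟩, hu⟩ := hR x
    rw [Finset.sum_eq_single r, if_pos hrx]
    · obtain ⟨c, rfl⟩ := isConj_iff.1 hrx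
      exact hφ c r
    · intro s hs hsr
      exact if_neg fun h => hsr (hu s ⟨hs, h⟩)
    · exact fun h => absurd hr h
  rw [Finset.sum_congr rfl fun x _ => h1 x, Finset.sum_comm]
  refine Finset.sum_congr rfl fun r _ => ?_
  rw [← Finset.sum_filter, Finset.sum_const, nsmul_eq_mul]
  congr 1
  have h2 := Subgroup.ncard_subgroupClass_mul_card ⊤ r
  rw [top_inf_eq, Subgroup.card_top] at h2
  have h3 : subgroupClass ⊤ r = ((Finset.univ.filter fun x => IsConj r x : Finset H) : Set H) := by
    ext x
    simp [subgroupClass, isConj_iff]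
  rw [h3, Set.ncard_coe_finset] at h2
  rw [← h2, Nat.cast_mul, mul_div_cancel_right₀]
  exact Nat.cast_ne_zero.2 Nat.card_pos.ne'

namespace Subgroup

variable {G : Type*} [Group G]

theorem centralizer_pair (h z : G) :
    centralizer ({h, z} : Set G) = centralizer {h} ⊓ centralizer {z} := by
  ext c
  simp [mem_centralizer_iff, mem_inf]

/-- Summing over classes of `C_G(z)` produces centralizers taken inside that subgroup; this turns
them into `C_G(h, z)`. -/
theorem card_centralizer_singleton_centralizer {z : G} (h : centralizer ({z} : Set G)) :
    Nat.card (centralizer ({h} : Set (centralizer ({z} : Set G)))) =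
      Nat.card (centralizer ({(h : G), z} : Set G)) := by
  have e : centralizer ({h} : Set (centralizer ({z} : Set G))) =
      (centralizer {(h : G)}).subgroupOf (centralizer {z}) := by
    ext c
    simp only [mem_subgroupOf, mem_centralizer_singleton_iff, Subtype.ext_iff, coe_mul]
  rw [e, centralizer_pair, ← inf_subgroupOf_right]
  exact Nat.card_congr (subgroupOfEquivOfLe inf_le_right).toEquiv

/-- Orbit-stabilizer for `C_G(h)` acting on `z`; it passes from the weights of the first formula to
those of the second. -/
theorem ncard_subgroupClass_centralizer [Finite G] (h z : G) :
    1 / (Nat.card (centralizer ({h, z} : Set G)) : ℂ) =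
      (subgroupClass (centralizer {h}) z).ncard / Nat.card (centralizer ({h} : Set G)) := by
  have h0 : (Nat.card (centralizer ({h, z} : Set G)) : ℂ) ≠ 0 :=
    Nat.cast_ne_zero.2 Nat.card_pos.ne'
  have h1 : (Nat.card (centralizer ({h} : Set G)) : ℂ) ≠ 0 :=
    Nat.cast_ne_zero.2 Nat.card_pos.ne'
  rw [div_eq_div_iff h0 h1, one_mul, centralizer_pair,
    ← ncard_subgroupClass_mul_card (centralizer {h}) z, Nat.cast_mul]

theorem card_centralizer_conj (t h : G) :
    Nat.card (centralizer ({t * h * t⁻¹} : Set G)) = Nat.card (centralizer ({h} : Set G)) := by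
  have e : centralizer ({t * h * t⁻¹} : Set G) =
      (centralizer ({h} : Set G)).map (MulAut.conj t).toMonoidHom := by
    ext c
    simp only [mem_map_equiv, mem_centralizer_singleton_iff, MulAut.conj_symm_apply]
    constructor
    · intro hc
      have := congrArg (fun k => t⁻¹ * k * t) hc
      simpa [mul_assoc] using this
    · intro hc
      have := congrArg (fun k => t * k * t⁻¹) hc
      simpa [mul_assoc] using this
  rw [e]
  exact (Nat.card_congr ((centralizer ({h} : Set G)).equivMapOfInjective _
    (MulAut.conj t).injective).toEquiv).symm

end Subgroup

/-! ### The sets `G_m(h, z)`. -/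

section PowerSets

variable {G : Type*} [Group G]

/-- Both `x` and `h * x` commute with their common power `z`, hence so does `h`. -/
theorem powerSet_eq_empty {m : ℤ} {h z : G} (hz : h ∉ Subgroup.centralizer {z}) :
    powerSet m h z = ∅ := by
  refine Set.eq_empty_iff_forall_notMem.2 fun x hx => hz ?_
  have h1 : Commute x z := hx.1 ▸ (Commute.refl x).zpow_right m
  have h2 : Commute (h * x) z := hx.2 ▸ (Commute.refl (h * x)).zpow_right m
  rw [Subgroup.mem_centralizer_singleton_iff]
  simpa using (h2.mul_left h1.inv_left).eq

theorem ncard_powerSet_conj (m : ℤ) (c h z : G) :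
    (powerSet m (c * h * c⁻¹) (c * z * c⁻¹)).ncard = (powerSet m h z).ncard := by
  rw [← Set.ncard_image_of_injective (powerSet m h z) (MulAut.conj c).injective]
  congr 1
  ext x
  simp only [← MulAut.conj_apply]
  constructor
  · intro hx
    refine ⟨(MulAut.conj c).symm x, ?_, (MulAut.conj c).apply_symm_apply x⟩
    refine ⟨(MulAut.conj c).injective ?_, (MulAut.conj c).injective ?_⟩
    · rw [map_zpow, MulEquiv.apply_symm_apply, hx.1]
    · rw [map_zpow, map_mul, MulEquiv.apply_symm_apply, hx.2]
  · rintro ⟨y, hy, rfl⟩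
    exact ⟨by rw [← map_zpow, hy.1], by rw [← map_mul, ← map_zpow, hy.2]⟩

end PowerSets

namespace DrinfeldDouble

/-! ### Indicators as class sums. -/

section Indicators

variable {G : Type*} [Group G] [DecidableEq G] [Fintype G]

/-- The group element `c` sits in `D(G)` as `∑ b, p_b ⋈ c`. Moving this factor cyclically under the
trace gives the invariance. -/
theorem character_conj {V : Type*} [AddCommGroup V] [Module ℂ V]
    (π : DrinfeldDouble G →ₐ[ℂ] Module.End ℂ V) (c x y : G) :
    character π (c * x * c⁻¹) (c * y * c⁻¹) = character π x y := by
  have h1 : ∀ a y z : G, basisElem a y * ∑ b : G, basisElem b z = basisElem a (y * z) := by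
    intro a y z
    have e : ∀ b : G, a = y * b * y⁻¹ ↔ y⁻¹ * a * y = b := by
      intro b
      constructor <;> rintro rfl <;> group
    simp [Finset.mul_sum, basisElem_mul, e]
  have h2 : (∑ b : G, basisElem b c) * basisElem x (y * c⁻¹) =
      basisElem (c * x * c⁻¹) (c * y * c⁻¹) := by
    simp [Finset.sum_mul, basisElem_mul, mul_assoc]
  rw [character, character, ← h2, map_mul, LinearMap.trace_mul_comm, ← map_mul, h1,
    inv_mul_cancel_right]

/-- The indicators as sums over commuting pairs of group elements. -/
theorem indicator_eq_sum_powerSet (m : ℤ) {V : Type*} [AddCommGroup V] [Module ℂ V]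
    (π : DrinfeldDouble G →ₐ[ℂ] Module.End ℂ V) :
    indicator m π = (Nat.card G : ℂ)⁻¹ *
      ∑ z : G, ∑ h : G, ((powerSet m h z).ncard : ℂ) * character π h z := by
  rw [indicator_eq_sum_prod]
  congr 1
  rw [Finset.sum_comm, Finset.sum_comm (f := fun z h => _ * _)]
  refine Finset.sum_congr rfl fun h _ => ?_
  have e : ∀ z : G, powerSet m h z =
      ((Finset.univ.filter fun y : G => y ^ m = z ∧ (h * y) ^ m = z : Finset G) : Set G) := by
    intro z
    ext y
    simp [powerSet]
  simp only [e, Set.ncard_coe_finset, ← nsmul_eq_mul, ← Finset.sum_const, Finset.sum_filter]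
  rw [Finset.sum_comm]
  refine Finset.sum_congr rfl fun y _ => ?_
  -- Each `y` is counted for the single value `z = y ^ m`.
  rw [Finset.sum_eq_single (y ^ m)]
  · simp
  · intro z _ hz
    exact if_neg fun h' => hz h'.1.symm
  · simp

/-- Reducing `z` to `R` leaves conjugation by `C_G(z)` as the symmetry in `h`. The weights multiply
to `|G|⁻¹ · |G|/|C_G(z)| · |C_G(z)|/|C_G(h, z)| = 1/|C_G(h, z)|`. -/
theorem indicator_eq_sum_reps (m : ℤ) {V : Type*} [AddCommGroup V] [Module ℂ V]
    (π : DrinfeldDouble G →ₐ[ℂ] Module.End ℂ V)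
    {R : Finset G} (hR : IsClassReps R)
    {S : (z : G) → Finset (Subgroup.centralizer {z})} (hS : ∀ z ∈ R, IsClassReps (S z)) :
    indicator m π = ∑ z ∈ R, ∑ h ∈ S z,
      1 / (Nat.card (Subgroup.centralizer {(h : G), z}) : ℂ) * gammaFun m z h *
        character π h z := by
  classical
  have hF : ∀ c h z : G, ((powerSet m (c * h * c⁻¹) (c * z * c⁻¹)).ncard : ℂ) *
      character π (c * h * c⁻¹) (c * z * c⁻¹) =
        ((powerSet m h z).ncard : ℂ) * character π h z := fun c h z => by
    rw [ncard_powerSet_conj, character_conj]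
  rw [indicator_eq_sum_powerSet, hR.sum_eq, Finset.mul_sum]
  · refine Finset.sum_congr rfl fun z hz => ?_
    have h1 : ∑ h : G, ((powerSet m h z).ncard : ℂ) * character π h z =
        ∑ h : Subgroup.centralizer {z}, ((powerSet m (h : G) z).ncard : ℂ) *
          character π (h : G) z := by
      rw [← Finset.sum_filter_add_sum_filter_not Finset.univ (· ∈ Subgroup.centralizer {z}),
        Finset.sum_subtype _ (p := (· ∈ Subgroup.centralizer {z})) (by simp), add_eq_left]
      refine Finset.sum_eq_zero fun h hh => ?_
      rw [powerSet_eq_empty (Finset.mem_filter.1 hh).2]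
      simp
    rw [h1, (hS z hz).sum_eq, Finset.mul_sum, Finset.mul_sum]
    · refine Finset.sum_congr rfl fun h _ => ?_
      have h2 : (Nat.card G : ℂ) ≠ 0 := Nat.cast_ne_zero.2 Nat.card_pos.ne'
      have h3 : (Nat.card (Subgroup.centralizer {z}) : ℂ) ≠ 0 :=
        Nat.cast_ne_zero.2 Nat.card_pos.ne'
      rw [Subgroup.card_centralizer_singleton_centralizer, gammaFun]
      field_simp
    · intro c h
      have hc : (c : G) * z * (c : G)⁻¹ = z := by
        rw [Subgroup.mem_centralizer_singleton_iff.1 c.2, mul_inv_cancel_right]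
      have := hF c h z
      rwa [hc] at this
  -- The inner sum is a class function of `z`: reindex `h` by conjugation.
  · intro c z
    refine (Fintype.sum_equiv (MulAut.conj c).toEquiv _ _ fun h => ?_).symm
    exact (hF c h z).symm

end Indicators

/-! ### Characters of the induced modules. -/

section InducedModules

variable {G : Type*} [Group G] {W : Type*} [AddCommGroup W] [Module ℂ W] (g : G)
  (ρ : Representation ℂ (Subgroup.centralizer {g}) W)

/-- Evaluation at the identity on the module attached to `g` and `ρ`. -/
def evalOne : moduleSpace g ρ →ₗ[ℂ] W :=
  (LinearMap.proj 1).comp (moduleSpace g ρ).subtype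

open Classical in
/-- The functions supported on `C_G(g)` in the module attached to `g` and `ρ`. -/
noncomputable def extendByZero : W →ₗ[ℂ] moduleSpace g ρ where
  toFun w := ⟨fun x => if hx : x ∈ Subgroup.centralizer {g} then ρ ⟨x, hx⟩⁻¹ w else 0, by
    intro x c
    beta_reduce
    by_cases hx : x ∈ Subgroup.centralizer {g}
    · rw [dif_pos hx, dif_pos (mul_mem hx c.2), ← Module.End.mul_apply, ← map_mul, ← mul_inv_rev]
      rfl
    · rw [dif_neg hx, dif_neg ((Subgroup.mul_mem_cancel_right _ c.2).not.2 hx), map_zero]⟩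
  map_add' v w := by
    ext x
    by_cases hx : x ∈ Subgroup.centralizer {g} <;> simp [hx]
  map_smul' r w := by
    ext x
    by_cases hx : x ∈ Subgroup.centralizer {g} <;> simp [hx]

theorem extendByZero_apply_of_mem (w : W) {x : G} (hx : x ∈ Subgroup.centralizer {g}) :
    (extendByZero g ρ w).1 x = ρ ⟨x, hx⟩⁻¹ w := dif_pos hx

theorem extendByZero_apply_of_notMem (w : W) {x : G} (hx : x ∉ Subgroup.centralizer {g}) :
    (extendByZero g ρ w).1 x = 0 := dif_neg hx

variable [DecidableEq G] [Fintype G]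

/-- `p_g` projects onto functions supported on `C_G(g)`, and such a function is determined by its
value at `1`. -/
theorem moduleAct_self (y : Subgroup.centralizer {g}) :
    moduleAct g ρ g y = (extendByZero g ρ).comp ((ρ y).comp (evalOne g ρ)) := by
  refine LinearMap.ext fun f => Subtype.ext (funext fun x => ?_)
  rw [moduleAct_apply, LinearMap.comp_apply, LinearMap.comp_apply]
  have e : g = x * g * x⁻¹ ↔ x ∈ Subgroup.centralizer {g} := by
    rw [Subgroup.mem_centralizer_singleton_iff, eq_mul_inv_iff_mul_eq, eq_comm]
  by_cases hx : x ∈ Subgroup.centralizer {g}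
  · rw [if_pos (e.2 hx), extendByZero_apply_of_mem g ρ _ hx, ← Module.End.mul_apply, ← map_mul]
    -- The equivariance of `f`, applied at `1`, expresses `f (y⁻¹ * x)` through `f 1`.
    have h := f.2 1 (y⁻¹ * ⟨x, hx⟩)
    rw [one_mul, mul_inv_rev, inv_inv] at h
    exact h
  · rw [if_neg (e.not.2 hx), extendByZero_apply_of_notMem g ρ _ hx]

/-- The character of the module attached to `g` and `ρ` at `p_g ⋈ y`, for `y ∈ C_G(g)`. -/
theorem character_module_self [FiniteDimensional ℂ W] (y : Subgroup.centralizer {g}) :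
    character (module g ρ) g y = ρ.character y := by
  -- With this retraction, cyclicity of the trace reduces the factorization through `W` to the trace
  -- of `ρ y`.
  have h : (evalOne g ρ).comp (extendByZero g ρ) = LinearMap.id := by
    refine LinearMap.ext fun w => ?_
    have := extendByZero_apply_of_mem g ρ w (one_mem _)
    have h1 : (⟨1, one_mem _⟩ : Subgroup.centralizer {g})⁻¹ = 1 := inv_one
    rw [h1, map_one] at this
    exact this
  have h' : module g ρ (basisElem g y) = moduleAct g ρ g y := lift_basisElem _ _ _
  rw [character, h', moduleAct_self, LinearMap.trace_comp_comm', LinearMap.comp_assoc, h,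
    LinearMap.comp_id]
  rfl

/-- The character of the module attached to `g` and `ρ` vanishes at `p_a ⋈ y` unless `a` is
conjugate to `g`. -/
theorem character_module_of_not_isConj {a : G} (ha : ¬ IsConj g a) (y : G) :
    character (module g ρ) a y = 0 := by
  have h' : module g ρ (basisElem a y) = moduleAct g ρ a y := lift_basisElem _ _ _
  have h : moduleAct g ρ a y = 0 := by
    refine LinearMap.ext fun f => Subtype.ext (funext fun x => ?_)
    rw [moduleAct_apply, if_neg fun h => ha (isConj_iff.2 ⟨x, h.symm⟩)]
    rfl
  rw [character, h', h, map_zero]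

end InducedModules

end DrinfeldDouble

/-! ### The three formulas. -/

/-- The linear extension of a function on a group as a linear map. -/
theorem extendToGroupAlgebra_eq_linearCombination {H : Type*} (η : H → ℂ)
    (u : MonoidAlgebra ℂ H) :
    extendToGroupAlgebra η u = Finsupp.linearCombination ℂ η u.coeff := rfl

theorem mainTheorem3 {G : Type*} [Group G] [Fintype G] [DecidableEq G] (m : ℤ)
    (R : Finset G) (hR : IsClassReps R)
    (S : (z : G) → Finset (Subgroup.centralizer {z})) (hS : ∀ z ∈ R, IsClassReps (S z))
    (t : (z : G) → Subgroup.centralizer {z} → G)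
    (ht : ∀ z ∈ R, ∀ h ∈ S z, t z h * (h : G) * (t z h)⁻¹ ∈ R) :
    (∀ {V : Type*} [AddCommGroup V] [Module ℂ V] [FiniteDimensional ℂ V]
      (π : DrinfeldDouble G →ₐ[ℂ] Module.End ℂ V),
      DrinfeldDouble.indicator m π = ∑ z ∈ R, ∑ h ∈ S z,
        1 / (Nat.card (Subgroup.centralizer {(h : G), z}) : ℂ) * gammaFun m z h *
          DrinfeldDouble.character π (t z h * (h : G) * (t z h)⁻¹) (t z h * z * (t z h)⁻¹)) ∧
    (∀ g ∈ R, ∀ {W : Type*} [AddCommGroup W] [Module ℂ W] [FiniteDimensional ℂ W]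
      (ρ : Representation ℂ (Subgroup.centralizer {g}) W),
      DrinfeldDouble.indicator m (DrinfeldDouble.module g ρ) =
        1 / (Nat.card (Subgroup.centralizer {g}) : ℂ) * ∑ z ∈ R, ∑ h ∈ S z,
          (if hg : t z h * (h : G) * (t z h)⁻¹ = g then
            ((subgroupClass (Subgroup.centralizer {(h : G)}) z).ncard : ℂ) * gammaFun m z h *
              ρ.character ⟨t z h * z * (t z h)⁻¹, conj_mem_centralizer h hg⟩
          else 0) ∧
      DrinfeldDouble.indicator m (DrinfeldDouble.module g ρ) =
        extendToGroupAlgebra ρ.character (muElem m R S t g)) := by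
  refine ⟨fun π => ?_, fun g hg W _ _ _ ρ => ?_⟩
  · simp only [DrinfeldDouble.character_conj]
    exact DrinfeldDouble.indicator_eq_sum_reps m π hR hS
  have key : DrinfeldDouble.indicator m (DrinfeldDouble.module g ρ) =
        1 / (Nat.card (Subgroup.centralizer {g}) : ℂ) * ∑ z ∈ R, ∑ h ∈ S z,
          (if hg : t z h * (h : G) * (t z h)⁻¹ = g then
            ((subgroupClass (Subgroup.centralizer {(h : G)}) z).ncard : ℂ) * gammaFun m z h *
              ρ.character ⟨t z h * z * (t z h)⁻¹, conj_mem_centralizer h hg⟩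
          else 0) := by
    rw [DrinfeldDouble.indicator_eq_sum_reps m _ hR hS, Finset.mul_sum]
    refine Finset.sum_congr rfl fun z hz => ?_
    rw [Finset.mul_sum]
    refine Finset.sum_congr rfl fun h hh => ?_
    -- Conjugating by `t z h` puts the first argument in `R`, where being conjugate to `g` means
    -- being equal to `g`.
    rw [← DrinfeldDouble.character_conj _ (t z h)]
    split_ifs with hgh
    · have h1 := DrinfeldDouble.character_module_self g ρ
        ⟨t z h * z * (t z h)⁻¹, conj_mem_centralizer h hgh⟩
      -- Since `g` is conjugate to `h`, `|C_G(h)| = |C_G(g)|`, so this denominator leaves the sums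
      -- as a common factor.
      rw [hgh, h1, Subgroup.ncard_subgroupClass_centralizer,
        ← Subgroup.card_centralizer_conj (t z h) h, hgh]
      ring
    · rw [DrinfeldDouble.character_module_of_not_isConj g ρ fun hc => hgh ?_]
      · simp
      -- Both `g(h)` and `g` lie in `R`, so if conjugate they coincide by uniqueness.
      obtain ⟨r, -, hu⟩ := hR g
      exact (hu _ ⟨ht z hz h hh, hc.symm⟩).trans (hu g ⟨hg, IsConj.refl g⟩).symm
  refine ⟨key, key.trans ?_⟩
  rw [muElem, extendToGroupAlgebra_eq_linearCombination, MonoidAlgebra.coeff_smul, map_smul,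
    MonoidAlgebra.coeff_sum, map_sum, one_div, smul_eq_mul]
  congr 1
  refine Finset.sum_congr rfl fun z _ => ?_
  rw [MonoidAlgebra.coeff_sum, map_sum]
  refine Finset.sum_congr rfl fun h _ => ?_
  split_ifs
  · rw [MonoidAlgebra.coeff_single, Finsupp.linearCombination_single, smul_eq_mul]
  · simp
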